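/- Let $n$ products have qualities $\theta_1\ge\theta_2\ge\dots\ge\theta_n\ge 0$. If a set $S\subseteq\{1,\dots,n\}$ of products is displayed and the prices are $(p_i)_{i\in S}$, put $a_i=\exp(\theta_i-p_i)$ and let product $i\in S$ have demand $q_i=a_i/(1+\sum_{j\in S}a_j)$. In the Bertrand game with set of players $S$, each seller $i\in S$ chooses a price $p_i\ge 0$ and receives $p_iq_i$. The equilibrium revenue of $S$ is $\sum_{i\in S}p_iq_i$ at the (unique) pure Nash equilibrium of this game; write $\bar q_i$ for the demands at this equilibrium. A non-empty set is called optimal if its equilibrium revenue is the largest among all non-empty subsets of $\{1,\dots,n\}$. Theorem. Let $S$ be an optimal set with $k^*=|S|\ge 3$. No bound on the demands is assumed. Then: 1. $S$ consists of the top $k^*$ products (up to products of equal quality): $\theta_i\ge\theta_j$ for all $i\in S$ and $j\notin S$; and the set $\{1,\dots,k^*\}$ is optimal. 2. At the Nash equilibrium of the game played by $S$, every product $i\in S$ has demand $\bar q_i<1/2$. Moreover, for every $x\ge e^{-1}$ the Lambert function $W$ (where $W(x)$ is the unique real solution $w$ of $we^w=x$) satisfies $W(x)\ge \frac{2x}{e+x}$.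 -/

import Mathlib

/-!
Multinomial-logit price competition (Bertrand game) between displayed products.
Products are indexed by `Fin n`; product `i` has quality `θ i`, and a price vector is a function
`p : Fin n → ℝ` of which only the entries at displayed products matter.
-/

namespace MNLBertrand

noncomputable section

/-- Attraction `a_i = exp (θ_i - p_i)` of product `i`. -/
def attraction {n : ℕ} (θ p : Fin n → ℝ) (i : Fin n) : ℝ :=
  Real.exp (θ i - p i)

/-- Demand (market share) `q_i = a_i / (1 + ∑_{j ∈ S} a_j)` of product `i` when the set `S` is
displayed; the outside option has attraction `1`. -/
def demand {n : ℕ} (θ : Fin n → ℝ) (S : Finset (Fin n)) (p : Fin n → ℝ) (i : Fin n) : ℝ :=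
  attraction θ p i / (1 + ∑ j ∈ S, attraction θ p j)

/-- Payoff of seller `i`: price times demand. -/
def sellerRevenue {n : ℕ} (θ : Fin n → ℝ) (S : Finset (Fin n)) (p : Fin n → ℝ) (i : Fin n) : ℝ :=
  p i * demand θ S p i

/-- Total revenue of the market in which `S` is displayed. -/
def marketRevenue {n : ℕ} (θ : Fin n → ℝ) (S : Finset (Fin n)) (p : Fin n → ℝ) : ℝ :=
  ∑ i ∈ S, sellerRevenue θ S p i

/-- `p` is a pure Nash equilibrium of the Bertrand game with set of players `S`: prices are
non-negative and no seller in `S` gains by a unilateral change to another non-negative price. -/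
def IsNashEquilibrium {n : ℕ} (θ : Fin n → ℝ) (S : Finset (Fin n)) (p : Fin n → ℝ) : Prop :=
  (∀ i ∈ S, 0 ≤ p i) ∧
    ∀ i ∈ S, ∀ x : ℝ, 0 ≤ x →
      sellerRevenue θ S (Function.update p i x) i ≤ sellerRevenue θ S p i

/-- `R` is the market revenue at a Nash equilibrium of the Bertrand game played by `S`. -/
def IsEquilibriumRevenue {n : ℕ} (θ : Fin n → ℝ) (S : Finset (Fin n)) (R : ℝ) : Prop :=
  ∃ p : Fin n → ℝ, IsNashEquilibrium θ S p ∧ marketRevenue θ S p = R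

/-- Displaying `S` maximizes the equilibrium revenue among all non-empty sets of products. -/
def IsRevenueOptimal {n : ℕ} (θ : Fin n → ℝ) (S : Finset (Fin n)) : Prop :=
  S.Nonempty ∧
    ∃ R : ℝ, IsEquilibriumRevenue θ S R ∧
      ∀ T : Finset (Fin n), T.Nonempty → ∀ R' : ℝ, IsEquilibriumRevenue θ T R' → R' ≤ R

/-- The first `k` products; these are the `k` best ones when `θ` is non-increasing. -/
def topProducts (n k : ℕ) : Finset (Fin n) :=
  Finset.univ.filter fun i => i.val < k

/-- `w` is the value at `x` of the Lambert function: the unique real solution of `w * exp w = x`. -/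
def IsLambertW (x w : ℝ) : Prop :=
  w * Real.exp w = x ∧ ∀ v : ℝ, v * Real.exp v = x → v = w

end

end MNLBertrand

/-! Let `exp s` be the outside share. The first-order condition `p i * (1 - q i) = 1` makes a
seller's demand `q` and revenue `r = q / (1 - q)` functions of `θ i + s` alone, via `log q + 1 / (1
- q) = θ i + s`. An equilibrium is thus a root of the increasing equation `totalShare θ S s = 1`,
with revenue `totalProfit θ S s`. A seller with demand at least one half, in a market of at least
two, would earn more alone than the whole market does (`completedRevenue_lt_of_one_le_profit`). In
an optimal set all demands are therefore below one half. For the top products, fix `J = S \ {i}` and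
let the last seller's quality vary. Total revenue becomes a function of `s`, `completedRevenue`,
which lies strictly below its endpoint maximum as long as profits in `J` are at most one
(`completedRevenue_lt_max`). So if a better `j` is left out, either replacing `i` by `j` or dropping
`i` raises revenue; should profits in `J` exceed one on the way, a single seller does better. -/

namespace MNLBertrand

/-! ### Profit and share of one seller as functions of quality plus log outside share. -/

noncomputable section

open Filter Topology

/-- Quality (net of the logarithm of the outside share) at which a seller earns `exp y` in
equilibrium. -/
def logitLevel (y : ℝ) : ℝ :=
  y - Real.log (1 + Real.exp y) + 1 + Real.exp y

theorem hasDerivAt_logitLevel (y : ℝ) :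
    HasDerivAt logitLevel
      ((1 + Real.exp y + Real.exp y ^ 2) / (1 + Real.exp y)) y := by
  have hpos : 0 < 1 + Real.exp y := by positivity
  have h := ((((hasDerivAt_id y).sub
    (((Real.hasDerivAt_exp y).const_add 1).log hpos.ne')).add_const 1).add
    (Real.hasDerivAt_exp y))
  refine h.congr_deriv ?_
  field_simp
  ring

theorem continuous_logitLevel : Continuous logitLevel :=
  continuous_iff_continuousAt.2 fun y => (hasDerivAt_logitLevel y).continuousAt

theorem strictMono_logitLevel : StrictMono logitLevel := by
  refine strictMono_of_deriv_pos fun y => ?_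
  rw [(hasDerivAt_logitLevel y).deriv]
  positivity

theorem surjective_logitLevel : Function.Surjective logitLevel := by
  refine continuous_logitLevel.surjective ?_ ?_
  · refine tendsto_atTop_mono (f := fun y => y) (fun y => ?_) tendsto_id
    have h := Real.log_le_sub_one_of_pos (show 0 < 1 + Real.exp y by positivity)
    unfold logitLevel
    linarith
  · have hlin : Tendsto (fun y : ℝ => y + 2) atBot atBot :=
      tendsto_atBot_add_const_right _ _ tendsto_id
    refine tendsto_atBot_mono' atBot ?_ hlin
    filter_upwards [eventually_le_atBot 0] with y hy
    have h1 : 0 ≤ Real.log (1 + Real.exp y) :=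
      Real.log_nonneg (by linarith [Real.exp_pos y])
    have h2 : Real.exp y ≤ 1 := Real.exp_le_one_iff.2 hy
    unfold logitLevel
    linarith

/-- `logitLevel` as an order isomorphism of the real line. -/
def logitIso : ℝ ≃o ℝ :=
  strictMono_logitLevel.orderIsoOfSurjective _ surjective_logitLevel

/-- Equilibrium revenue of a seller whose quality plus log outside share is `t`. -/
def profit (t : ℝ) : ℝ :=
  Real.exp (logitIso.symm t)

/-- Equilibrium demand of a seller whose quality plus log outside share is `t`. -/
def share (t : ℝ) : ℝ :=
  profit t / (1 + profit t)

theorem profit_pos (t : ℝ) : 0 < profit t := Real.exp_pos _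

theorem share_pos (t : ℝ) : 0 < share t :=
  div_pos (profit_pos t) (by linarith [profit_pos t])

theorem one_sub_share (t : ℝ) : 1 - share t = 1 / (1 + profit t) := by
  have := profit_pos t
  unfold share
  field_simp
  ring

theorem one_div_one_sub_share (t : ℝ) : 1 / (1 - share t) = 1 + profit t := by
  rw [one_sub_share, one_div_one_div]

theorem share_mul_one_add_profit (t : ℝ) : share t * (1 + profit t) = profit t := by
  have := profit_pos t
  unfold share
  field_simp

theorem strictMono_profit : StrictMono profit :=
  Real.exp_strictMono.comp logitIso.symm.strictMono

theorem strictMono_share : StrictMono share := by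
  intro a b hab
  have h := strictMono_profit hab
  have ha := profit_pos a
  unfold share
  rw [div_lt_div_iff₀ (by linarith) (by linarith)]
  linarith

theorem profit_eq_of_log {r t : ℝ} (hr : 0 < r)
    (h : Real.log r - Real.log (1 + r) + 1 + r = t) : profit t = r := by
  have : logitIso (Real.log r) = t := by
    change logitLevel _ = t
    rw [logitLevel, Real.exp_log hr, h]
  rw [profit, ← this, OrderIso.symm_apply_apply, Real.exp_log hr]

theorem log_profit (t : ℝ) :
    Real.log (profit t) - Real.log (1 + profit t) + 1 + profit t = t := by
  have h : logitLevel (logitIso.symm t) = t := logitIso.apply_symm_apply t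
  rw [logitLevel] at h
  rw [profit, Real.log_exp]
  exact h

theorem log_share (t : ℝ) : Real.log (share t) + 1 + profit t = t := by
  have h := profit_pos t
  rw [share, Real.log_div h.ne' (by linarith)]
  exact log_profit t

theorem share_eq_exp (t : ℝ) : share t = Real.exp (t - (1 + profit t)) := by
  rw [← Real.exp_log (share_pos t)]
  congr 1
  linarith [log_share t]

theorem share_mul_exp_profit (x s : ℝ) :
    share (x + s) * Real.exp (profit (x + s)) = Real.exp (x - 1) * Real.exp s := by
  rw [share_eq_exp, ← Real.exp_add, ← Real.exp_add]
  ring_nf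

theorem share_eq_of_log {q t : ℝ} (hq : 0 < q) (hq1 : q < 1)
    (h : Real.log q + 1 / (1 - q) = t) : share t = q ∧ profit t = q / (1 - q) := by
  have h1 : 0 < 1 - q := by linarith
  have hp : profit t = q / (1 - q) := by
    refine profit_eq_of_log (by positivity) ?_
    have e : 1 + q / (1 - q) = 1 / (1 - q) := by field_simp; ring
    rw [e, Real.log_div hq.ne' h1.ne', Real.log_div one_ne_zero h1.ne', Real.log_one, ← h, ← e]
    ring
  refine ⟨?_, hp⟩
  rw [share, hp]
  field_simp
  ring

theorem hasDerivAt_profit (t : ℝ) :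
    HasDerivAt profit
      (profit t * (1 + profit t) / (1 + profit t + profit t ^ 2)) t := by
  have hp := profit_pos t
  have h := HasDerivAt.of_local_left_inverse (f := logitLevel) (g := logitIso.symm) (a := t)
    logitIso.symm.continuous.continuousAt (hasDerivAt_logitLevel (logitIso.symm t))
    (by positivity) (Eventually.of_forall fun y => logitIso.apply_symm_apply y)
  refine h.exp.congr_deriv ?_
  change profit t * ((1 + profit t + profit t ^ 2) / (1 + profit t))⁻¹ = _
  field_simp

/-- Derivative of `profit`, as a function of the profit. -/
def profitRate (r : ℝ) : ℝ :=
  r * (1 + r) / (1 + r + r ^ 2)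

/-- Derivative of `share`, as a function of the profit. -/
def shareRate (r : ℝ) : ℝ :=
  r / ((1 + r) * (1 + r + r ^ 2))

theorem profitRate_pos {r : ℝ} (hr : 0 < r) : 0 < profitRate r := by
  unfold profitRate; positivity

theorem shareRate_pos {r : ℝ} (hr : 0 < r) : 0 < shareRate r := by
  unfold shareRate; positivity

theorem hasDerivAt_share (t : ℝ) : HasDerivAt share (shareRate (profit t)) t := by
  have hp := profit_pos t
  have h := (hasDerivAt_profit t).div ((hasDerivAt_profit t).const_add 1)
    (show 1 + profit t ≠ 0 by positivity)
  refine h.congr_deriv ?_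
  unfold shareRate
  field_simp
  ring

theorem hasDerivAt_profitRate {r : ℝ} (hr : 0 < r) :
    HasDerivAt profitRate ((1 + 2 * r) / (1 + r + r ^ 2) ^ 2) r := by
  have h := ((hasDerivAt_id r).mul ((hasDerivAt_id r).const_add 1)).div
    (((hasDerivAt_id r).const_add 1).add ((hasDerivAt_id r).pow 2))
    (show 1 + r + r ^ 2 ≠ 0 by positivity)
  refine h.congr_deriv ?_
  simp only [id, Pi.add_apply, Pi.mul_apply, Pi.pow_apply]
  field_simp
  ring

theorem hasDerivAt_shareRate {r : ℝ} (hr : 0 < r) :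
    HasDerivAt shareRate
      ((1 - 2 * r ^ 2 - 2 * r ^ 3) / ((1 + r) * (1 + r + r ^ 2)) ^ 2) r := by
  have h := (hasDerivAt_id r).div (((hasDerivAt_id r).const_add 1).mul
    (((hasDerivAt_id r).const_add 1).add ((hasDerivAt_id r).pow 2)))
    (show (1 + r) * (1 + r + r ^ 2) ≠ 0 by positivity)
  refine h.congr_deriv ?_
  simp only [id, Pi.add_apply, Pi.mul_apply, Pi.pow_apply]
  field_simp
  ring

theorem hasDerivAt_profitRate_profit (t : ℝ) :
    HasDerivAt (fun t => profitRate (profit t))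
      ((1 + 2 * profit t) / (1 + profit t + profit t ^ 2) ^ 2 * profitRate (profit t)) t :=
  (hasDerivAt_profitRate (profit_pos t)).comp t (hasDerivAt_profit t)

theorem hasDerivAt_shareRate_profit (t : ℝ) :
    HasDerivAt (fun t => shareRate (profit t))
      ((1 - 2 * profit t ^ 2 - 2 * profit t ^ 3) /
        ((1 + profit t) * (1 + profit t + profit t ^ 2)) ^ 2 * profitRate (profit t)) t :=
  (hasDerivAt_shareRate (profit_pos t)).comp t (hasDerivAt_profit t)

/-- Here `1 - profitRate r = 1 / (1 + r + r ^ 2)`, so after dividing by `profitRate r` the claim is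
`r ^ 2 ≤ r`. This is where profits at most one are needed. -/
theorem sub_sq_le_deriv_profitRate {r : ℝ} (hr : 0 < r) (hr1 : r ≤ 1) :
    profitRate r - profitRate r ^ 2 ≤
      (1 + 2 * r) / (1 + r + r ^ 2) ^ 2 * profitRate r := by
  have hf := profitRate_pos hr
  have h : 1 - profitRate r ≤ (1 + 2 * r) / (1 + r + r ^ 2) ^ 2 := by
    have e : 1 - profitRate r = (1 + r + r ^ 2) / (1 + r + r ^ 2) ^ 2 := by
      unfold profitRate; field_simp; ring
    rw [e]
    exact div_le_div_of_nonneg_right (by nlinarith) (by positivity)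
  nlinarith [mul_le_mul_of_nonneg_right h hf.le]

theorem deriv_shareRate_le {r : ℝ} (hr : 0 < r) :
    (1 - 2 * r ^ 2 - 2 * r ^ 3) / ((1 + r) * (1 + r + r ^ 2)) ^ 2 * profitRate r ≤
      shareRate r := by
  have e : shareRate r = (1 + r + r ^ 2) ^ 2 / ((1 + r) * (1 + r + r ^ 2)) ^ 2 *
      profitRate r := by
    unfold profitRate shareRate; field_simp
  rw [e]
  refine mul_le_mul_of_nonneg_right ?_ (profitRate_pos hr).le
  gcongr
  nlinarith [pow_pos hr 2, pow_pos hr 3, pow_pos hr 4]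

theorem profitRate_le_four_mul_shareRate {r : ℝ} (hr : 0 < r) (hr1 : r ≤ 1) :
    profitRate r ≤ 4 * shareRate r := by
  have e : shareRate r = profitRate r / (1 + r) ^ 2 := by
    unfold profitRate shareRate; field_simp
  rw [e, ← mul_div_assoc, le_div_iff₀ (by positivity)]
  rw [mul_comm]
  exact mul_le_mul_of_nonneg_right (by nlinarith) (profitRate_pos hr).le

end

/-! ### Equilibria as roots of a scalar equation. -/

noncomputable section

open Filter Topology

/-- A price is a best reply among non-negative prices, against opponents (and outside option) of
total attraction `c`, iff it satisfies the first-order condition. -/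
theorem bestReply_iff {c t p : ℝ} (hc : 0 < c) :
    (0 ≤ p ∧ ∀ x : ℝ, 0 ≤ x → x * (Real.exp (t - x) / (c + Real.exp (t - x))) ≤
      p * (Real.exp (t - p) / (c + Real.exp (t - p)))) ↔
    p * (1 - Real.exp (t - p) / (c + Real.exp (t - p))) = 1 := by
  -- `z` is the ratio of the rivals' attraction to the seller's own at price `p`. The reciprocal
  -- demand `z * exp (x - p) + 1` is convex in `x`, so the tangent bound for `exp` at `0` makes the
  -- first-order condition sufficient globally.
  have hz : 0 < c * Real.exp (p - t) := by positivity
  set z := c * Real.exp (p - t) with hz_def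
  have key : ∀ x, Real.exp (t - x) / (c + Real.exp (t - x)) =
      1 / (z * Real.exp (x - p) + 1) := by
    intro x
    have h1 : z * Real.exp (x - p) = c * Real.exp (x - t) := by
      rw [hz_def, mul_assoc, ← Real.exp_add]; ring_nf
    have h2 : Real.exp (t - x) * Real.exp (x - t) = 1 := by
      rw [← Real.exp_add]; simp
    rw [h1, div_eq_div_iff (by positivity) (by positivity)]
    linear_combination c * h2
  have keyp : Real.exp (t - p) / (c + Real.exp (t - p)) = 1 / (z + 1) := by
    rw [key p]; simp
  have foc : p * (1 - Real.exp (t - p) / (c + Real.exp (t - p))) = 1 ↔ p * z = z + 1 := by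
    rw [keyp]
    have : p * (1 - 1 / (z + 1)) = p * z / (z + 1) := by field_simp; ring
    rw [this, div_eq_one_iff_eq (by positivity)]
  have ineq : ∀ x, x * (Real.exp (t - x) / (c + Real.exp (t - x))) ≤
      p * (Real.exp (t - p) / (c + Real.exp (t - p))) ↔
      x * (z + 1) ≤ p * (z * Real.exp (x - p) + 1) := by
    intro x
    rw [keyp, key x, mul_one_div, mul_one_div, div_le_div_iff₀ (by positivity) (by positivity)]
  simp only [foc, ineq]
  constructor
  · rintro ⟨hp, h⟩
    -- Price `1` earns a positive amount, so `p = 0` is not a best reply and `p` is an interior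
    -- optimum.
    have hp0 : 0 < p := by
      rcases hp.lt_or_eq with h0 | h0
      · exact h0
      · have := h 1 zero_le_one
        rw [← h0] at this
        linarith
    have hmin : IsLocalMin (fun x => p * (z * Real.exp (x - p) + 1) - x * (z + 1)) p := by
      filter_upwards [eventually_gt_nhds hp0] with x hx
      have := h x hx.le
      simp only [sub_self, Real.exp_zero, mul_one]
      linarith
    have hd : HasDerivAt (fun x => p * (z * Real.exp (x - p) + 1) - x * (z + 1))
        (p * (z * (Real.exp (p - p) * 1)) - 1 * (z + 1)) p :=
      (((((hasDerivAt_id p).sub_const p).exp.const_mul z).add_const 1).const_mul p).sub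
        ((hasDerivAt_id p).mul_const (z + 1))
    have := hmin.hasDerivAt_eq_zero hd
    simp only [sub_self, Real.exp_zero, mul_one] at this
    linarith
  · intro h
    have hp : 0 ≤ p := by
      by_contra hneg
      nlinarith
    refine ⟨hp, fun x _ => ?_⟩
    have h1 := Real.add_one_le_exp (x - p)
    have h2 : p * z * (x - p + 1) ≤ p * z * Real.exp (x - p) :=
      mul_le_mul_of_nonneg_left h1 (by positivity)
    rw [h] at h2
    have h3 : p * (z * Real.exp (x - p) + 1) = (z + 1) * Real.exp (x - p) + p := by
      rw [← h]; ring
    nlinarith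

variable {n : ℕ} (θ : Fin n → ℝ) (T : Finset (Fin n))

theorem attraction_pos (p : Fin n → ℝ) (i : Fin n) : 0 < attraction θ p i := Real.exp_pos _

theorem one_add_sum_attraction_pos (p : Fin n → ℝ) : 0 < 1 + ∑ j ∈ T, attraction θ p j := by
  have : 0 ≤ ∑ j ∈ T, attraction θ p j :=
    Finset.sum_nonneg fun j _ => (attraction_pos θ p j).le
  linarith

variable {T}

theorem demand_update (p : Fin n → ℝ) {i : Fin n} (hi : i ∈ T) (x : ℝ) :
    demand θ T (Function.update p i x) i =
      Real.exp (θ i - x) /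
        (1 + ∑ j ∈ T.erase i, attraction θ p j + Real.exp (θ i - x)) := by
  have h : ∑ j ∈ T.erase i, attraction θ (Function.update p i x) j =
      ∑ j ∈ T.erase i, attraction θ p j :=
    Finset.sum_congr rfl fun j hj => by
      simp [attraction, Function.update_of_ne (Finset.ne_of_mem_erase hj)]
  rw [demand, ← Finset.sum_erase_add _ _ hi, h]
  simp [attraction, add_assoc]

theorem sellerRevenue_update (p : Fin n → ℝ) {i : Fin n} (hi : i ∈ T) (x : ℝ) :
    sellerRevenue θ T (Function.update p i x) i =
      x * (Real.exp (θ i - x) /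
        (1 + ∑ j ∈ T.erase i, attraction θ p j + Real.exp (θ i - x))) := by
  rw [sellerRevenue, demand_update θ p hi, Function.update_self]

theorem isNashEquilibrium_iff {θ : Fin n → ℝ} {p : Fin n → ℝ} :
    IsNashEquilibrium θ T p ↔ ∀ i ∈ T, p i * (1 - demand θ T p i) = 1 := by
  rw [IsNashEquilibrium, ← forall₂_and]
  refine forall₂_congr fun i hi => ?_
  have h1 := sellerRevenue_update θ p hi
  have h2 := demand_update θ p hi (p i)
  have h3 := h1 (p i)
  rw [Function.update_eq_self] at h2 h3
  rw [h2, ← bestReply_iff (one_add_sum_attraction_pos θ (T.erase i) p), h3]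
  simp only [h1]

variable (T)

/-- Sum of the outside share `exp s` and the shares of the products of `T` when every seller
prices optimally. -/
def totalShare (s : ℝ) : ℝ :=
  Real.exp s + ∑ i ∈ T, share (θ i + s)

/-- Sum of the profits of the products of `T` when the outside share is `exp s`. -/
def totalProfit (s : ℝ) : ℝ :=
  ∑ i ∈ T, profit (θ i + s)

theorem strictMono_totalShare : StrictMono (totalShare θ T) := by
  intro a b hab
  refine add_lt_add_of_lt_of_le (Real.exp_lt_exp.2 hab) (Finset.sum_le_sum fun i _ => ?_)
  exact (strictMono_share (by linarith)).le

theorem hasDerivAt_totalShare (s : ℝ) :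
    HasDerivAt (totalShare θ T)
      (Real.exp s + ∑ i ∈ T, shareRate (profit (θ i + s))) s := by
  refine (Real.hasDerivAt_exp s).add (HasDerivAt.fun_sum fun i _ => ?_)
  simpa using (hasDerivAt_share (θ i + s)).comp_const_add (θ i) s

theorem hasDerivAt_totalProfit (s : ℝ) :
    HasDerivAt (totalProfit θ T) (∑ i ∈ T, profitRate (profit (θ i + s))) s := by
  refine HasDerivAt.fun_sum fun i _ => ?_
  exact (hasDerivAt_profit (θ i + s)).comp_const_add (θ i) s

theorem exists_totalShare_eq_one : ∃ s, totalShare θ T s = 1 := by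
  have hA : 0 ≤ ∑ i ∈ T, Real.exp (θ i) := Finset.sum_nonneg fun i _ => (Real.exp_pos _).le
  have hcont : Continuous (totalShare θ T) :=
    continuous_iff_continuousAt.2 fun s => (hasDerivAt_totalShare θ T s).continuousAt
  -- This is the outside share at zero prices; it suffices since `share t ≤ exp t`.
  have hlow : totalShare θ T (-Real.log (1 + ∑ i ∈ T, Real.exp (θ i))) ≤ 1 := by
    set s := -Real.log (1 + ∑ i ∈ T, Real.exp (θ i)) with hs
    have he : Real.exp s = 1 / (1 + ∑ i ∈ T, Real.exp (θ i)) := by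
      rw [hs, Real.exp_neg, Real.exp_log (by linarith), one_div]
    have h1 : ∑ i ∈ T, share (θ i + s) ≤ ∑ i ∈ T, Real.exp (θ i) * Real.exp s := by
      refine Finset.sum_le_sum fun i _ => ?_
      rw [share_eq_exp, ← Real.exp_add]
      exact Real.exp_le_exp.2 (by linarith [profit_pos (θ i + s)])
    rw [← Finset.sum_mul] at h1
    have h2 : (1 + ∑ i ∈ T, Real.exp (θ i)) * Real.exp s = 1 := by
      rw [he]; field_simp
    unfold totalShare
    linarith
  have hhigh : 1 ≤ totalShare θ T 0 := by
    unfold totalShare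
    rw [Real.exp_zero]
    have := Finset.sum_nonneg (s := T) fun i _ => (share_pos (θ i + 0)).le
    linarith
  exact mem_range_of_exists_le_of_exists_ge hcont ⟨_, hlow⟩ ⟨_, hhigh⟩

variable {θ T}

theorem IsNashEquilibrium.exists_totalShare {p : Fin n → ℝ} (hp : IsNashEquilibrium θ T p) :
    ∃ s, totalShare θ T s = 1 ∧ marketRevenue θ T p = totalProfit θ T s ∧
      ∀ i ∈ T, demand θ T p i = share (θ i + s) := by
  rw [isNashEquilibrium_iff] at hp
  have hA := one_add_sum_attraction_pos θ T p
  set A := 1 + ∑ j ∈ T, attraction θ p j with hA_def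
  have hq : ∀ i ∈ T, share (θ i + -Real.log A) = demand θ T p i ∧
      profit (θ i + -Real.log A) = demand θ T p i / (1 - demand θ T p i) := by
    intro i hi
    have hd : demand θ T p i = attraction θ p i / A := rfl
    have ha := attraction_pos θ p i
    have hlt : demand θ T p i < 1 := by
      rw [hd, div_lt_one hA, hA_def]
      have := Finset.single_le_sum (fun j _ => (attraction_pos θ p j).le) hi
      linarith
    have h1 := hp i hi
    refine share_eq_of_log (by rw [hd]; positivity) hlt ?_
    have h2 : 1 / (1 - demand θ T p i) = p i := by
      rw [div_eq_iff (by linarith), h1]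
    rw [h2, hd, Real.log_div ha.ne' hA.ne', attraction, Real.log_exp]
    ring
  refine ⟨-Real.log A, ?_, ?_, fun i hi => (hq i hi).1.symm⟩
  · have hsum : ∑ i ∈ T, share (θ i + -Real.log A) = (∑ i ∈ T, attraction θ p i) / A := by
      rw [Finset.sum_div]
      exact Finset.sum_congr rfl fun i hi => (hq i hi).1
    rw [totalShare, hsum, Real.exp_neg, Real.exp_log hA, ← one_div, ← add_div, div_self hA.ne']
  · refine Finset.sum_congr rfl fun i hi => ?_
    have h1 := hp i hi
    have h3 : 1 - demand θ T p i ≠ 0 := fun h => by rw [h] at h1; simp at h1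
    rw [(hq i hi).2, sellerRevenue, eq_div_iff h3]
    linear_combination demand θ T p i * h1

theorem isEquilibriumRevenue_totalProfit {s : ℝ} (hs : totalShare θ T s = 1) :
    IsEquilibriumRevenue θ T (totalProfit θ T s) := by
  let p : Fin n → ℝ := fun i => 1 + profit (θ i + s)
  have ha : ∀ i, attraction θ p i * Real.exp s = share (θ i + s) := by
    intro i
    rw [share_eq_exp, attraction, ← Real.exp_add]
    congr 1
    ring
  have hA : (1 + ∑ j ∈ T, attraction θ p j) * Real.exp s = 1 := by
    rw [add_mul, Finset.sum_mul, Finset.sum_congr rfl fun i _ => ha i, one_mul]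
    exact hs
  have hd : ∀ i, demand θ T p i = share (θ i + s) := by
    intro i
    rw [demand, div_eq_iff (one_add_sum_attraction_pos θ T p).ne', ← ha i]
    linear_combination -(attraction θ p i) * hA
  refine ⟨p, isNashEquilibrium_iff.2 fun i _ => ?_, Finset.sum_congr rfl fun i _ => ?_⟩
  · have := profit_pos (θ i + s)
    rw [hd, one_sub_share]
    exact mul_one_div_cancel (by positivity)
  · rw [sellerRevenue, hd, mul_comm]
    exact share_mul_one_add_profit _

theorem isEquilibriumRevenue_iff {R : ℝ} :
    IsEquilibriumRevenue θ T R ↔ ∃ s, totalShare θ T s = 1 ∧ totalProfit θ T s = R := by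
  constructor
  · rintro ⟨p, hp, rfl⟩
    obtain ⟨s, hs, hR, -⟩ := hp.exists_totalShare
    exact ⟨s, hs, hR.symm⟩
  · rintro ⟨s, hs, rfl⟩
    exact isEquilibriumRevenue_totalProfit hs

theorem IsRevenueOptimal.totalProfit_le {S : Finset (Fin n)} (hS : IsRevenueOptimal θ S)
    {s t : ℝ} (hs : totalShare θ S s = 1) (hT : T.Nonempty) (ht : totalShare θ T t = 1) :
    totalProfit θ T t ≤ totalProfit θ S s := by
  obtain ⟨-, R, hR, hmax⟩ := hS
  obtain ⟨s', hs', rfl⟩ := isEquilibriumRevenue_iff.1 hR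
  obtain rfl := (strictMono_totalShare θ S).injective (hs'.trans hs.symm)
  exact hmax T hT _ (isEquilibriumRevenue_totalProfit ht)

end

/-! ### Revenue as the quality of one seller varies. -/

noncomputable section

variable {n : ℕ} (θ : Fin n → ℝ) (J : Finset (Fin n))

/-- Derivative of `totalShare`. -/
def totalShareRate (s : ℝ) : ℝ :=
  Real.exp s + ∑ i ∈ J, shareRate (profit (θ i + s))

/-- Derivative of `totalProfit`. -/
def totalProfitRate (s : ℝ) : ℝ :=
  ∑ i ∈ J, profitRate (profit (θ i + s))

/-- Total revenue when the share left over by the outside option and by `J` is the equilibrium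
demand of one further seller. -/
def completedRevenue (s : ℝ) : ℝ :=
  totalProfit θ J s + (1 / totalShare θ J s - 1)

theorem totalShare_pos (s : ℝ) : 0 < totalShare θ J s :=
  add_pos_of_pos_of_nonneg (Real.exp_pos _) (Finset.sum_nonneg fun _ _ => (share_pos _).le)

theorem totalShareRate_pos (s : ℝ) : 0 < totalShareRate θ J s :=
  add_pos_of_pos_of_nonneg (Real.exp_pos _)
    (Finset.sum_nonneg fun _ _ => (shareRate_pos (profit_pos _)).le)

variable {J}

theorem totalProfitRate_pos (hJ : J.Nonempty) (s : ℝ) : 0 < totalProfitRate θ J s :=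
  Finset.sum_pos (fun _ _ => profitRate_pos (profit_pos _)) hJ

variable (J)

theorem exists_hasDerivAt_totalShareRate_le (s : ℝ) :
    ∃ d ≤ totalShareRate θ J s, HasDerivAt (totalShareRate θ J) d s :=
  ⟨_, add_le_add_right (Finset.sum_le_sum fun _ _ => deriv_shareRate_le (profit_pos _)) _,
    (Real.hasDerivAt_exp s).add (HasDerivAt.fun_sum fun i _ =>
      (hasDerivAt_shareRate_profit (θ i + s)).comp_const_add (θ i) s)⟩

variable {J}

theorem exists_hasDerivAt_totalProfitRate_ge {s : ℝ} (hs : ∀ i ∈ J, profit (θ i + s) ≤ 1) :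
    ∃ d, totalProfitRate θ J s - totalProfitRate θ J s ^ 2 ≤ d ∧
      HasDerivAt (totalProfitRate θ J) d s := by
  refine ⟨_, ?_, HasDerivAt.fun_sum fun i _ =>
    (hasDerivAt_profitRate_profit (θ i + s)).comp_const_add (θ i) s⟩
  have h1 := Finset.sum_le_sum fun i hi =>
    sub_sq_le_deriv_profitRate (profit_pos (θ i + s)) (hs i hi)
  have h2 : ∑ i ∈ J, profitRate (profit (θ i + s)) ^ 2 ≤ totalProfitRate θ J s ^ 2 :=
    Finset.sum_sq_le_sq_sum_of_nonneg fun i _ => (profitRate_pos (profit_pos _)).le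
  rw [Finset.sum_sub_distrib] at h1
  have h3 : ∑ i ∈ J, profitRate (profit (θ i + s)) = totalProfitRate θ J s := rfl
  rw [h3] at h1
  exact le_trans (by linarith) h1

/-- With `G = totalShareRate` and `F = totalProfitRate`, the bounds `G' ≤ G` and `F' ≥ F - F ^ 2`
give `(G / F)' ≤ G`, and `G` is the derivative of `totalShare`. -/
theorem monotoneOn_totalShare_sub_rate_div_rate (hJ : J.Nonempty) {b : ℝ}
    (hb : ∀ i ∈ J, profit (θ i + b) ≤ 1) :
    MonotoneOn (fun s => totalShare θ J s - totalShareRate θ J s / totalProfitRate θ J s)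
      (Set.Iic b) := by
  have key : ∀ s ≤ b, ∃ d, 0 ≤ d ∧ HasDerivAt
      (fun s => totalShare θ J s - totalShareRate θ J s / totalProfitRate θ J s) d s := by
    intro s hs
    have hF := totalProfitRate_pos θ hJ s
    have hG := totalShareRate_pos θ J s
    obtain ⟨dG, hdG, hG'⟩ := exists_hasDerivAt_totalShareRate_le θ J s
    obtain ⟨dF, hdF, hF'⟩ := exists_hasDerivAt_totalProfitRate_ge θ (s := s) fun i hi =>
      (strictMono_profit.monotone (by linarith)).trans (hb i hi)
    refine ⟨_, ?_, (hasDerivAt_totalShare θ J s).sub (hG'.div hF' hF.ne')⟩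
    change 0 ≤ totalShareRate θ J s - _
    rw [sub_nonneg, div_le_iff₀ (by positivity)]
    nlinarith [mul_le_mul_of_nonneg_right hdG hF.le, mul_le_mul_of_nonneg_left hdF hG.le]
  refine monotoneOn_of_deriv_nonneg (convex_Iic b) ?_ ?_ ?_
  · intro s hs
    obtain ⟨d, -, h⟩ := key s hs
    exact h.continuousAt.continuousWithinAt
  · intro s hs
    rw [interior_Iic] at hs
    obtain ⟨d, -, h⟩ := key s hs.le
    exact h.differentiableAt.differentiableWithinAt
  · intro s hs
    rw [interior_Iic] at hs
    obtain ⟨d, hd, h⟩ := key s hs.le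
    rwa [h.deriv]

theorem one_quarter_lt_rate_div_rate (hJ : J.Nonempty) {s : ℝ}
    (hs : ∀ i ∈ J, profit (θ i + s) ≤ 1) :
    1 / 4 < totalShareRate θ J s / totalProfitRate θ J s := by
  rw [lt_div_iff₀ (totalProfitRate_pos θ hJ s)]
  have h := Finset.sum_le_sum fun i hi =>
    profitRate_le_four_mul_shareRate (profit_pos (θ i + s)) (hs i hi)
  rw [← Finset.mul_sum] at h
  have := Real.exp_pos s
  unfold totalShareRate totalProfitRate
  linarith

/-- The sign of the derivative of `completedRevenue` changes at most once, from `-` to `+`. -/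
theorem rate_div_rate_lt_totalShare_sq (hJ : J.Nonempty) {a s b : ℝ} (has : a < s) (hsb : s ≤ b)
    (hb : ∀ i ∈ J, profit (θ i + b) ≤ 1)
    (ha : totalShareRate θ J a / totalProfitRate θ J a ≤ totalShare θ J a ^ 2) :
    totalShareRate θ J s / totalProfitRate θ J s < totalShare θ J s ^ 2 := by
  have h1 := monotoneOn_totalShare_sub_rate_div_rate θ hJ hb (has.le.trans hsb) hsb has.le
  have h2 := one_quarter_lt_rate_div_rate θ hJ (s := a) fun i hi =>
    (strictMono_profit.monotone (by linarith)).trans (hb i hi)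
  have h3 := strictMono_totalShare θ J has
  have h4 := totalShare_pos θ J a
  simp only at h1
  -- Beyond `1 / 2` the map `B ↦ B ^ 2 - B` increases strictly; adding the monotone `B - G / F`
  -- shows that `B ^ 2 - G / F` does too.
  have h5 : 1 / 2 < totalShare θ J a := by nlinarith
  nlinarith

theorem hasDerivAt_completedRevenue (s : ℝ) :
    HasDerivAt (completedRevenue θ J)
      (totalProfitRate θ J s - totalShareRate θ J s / totalShare θ J s ^ 2) s := by
  have h := (hasDerivAt_totalProfit θ J s).add
    ((((hasDerivAt_const s (1 : ℝ)).div (hasDerivAt_totalShare θ J s)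
      (totalShare_pos θ J s).ne')).sub_const 1)
  refine h.congr_deriv ?_
  simp only [totalShareRate, totalProfitRate]
  ring

theorem completedRevenue_lt_max (hJ : J.Nonempty) {a s b : ℝ} (has : a < s) (hsb : s < b)
    (hb : ∀ i ∈ J, profit (θ i + b) ≤ 1) :
    completedRevenue θ J s < max (completedRevenue θ J a) (completedRevenue θ J b) := by
  have hcont : Continuous (completedRevenue θ J) :=
    continuous_iff_continuousAt.2 fun s => (hasDerivAt_completedRevenue θ s).continuousAt
  rw [lt_max_iff]
  by_cases h : totalShareRate θ J s / totalProfitRate θ J s ≤ totalShare θ J s ^ 2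
  · right
    refine strictMonoOn_of_deriv_pos (convex_Icc s b) hcont.continuousOn (fun x hx => ?_)
      (Set.left_mem_Icc.2 hsb.le) (Set.right_mem_Icc.2 hsb.le) hsb
    rw [interior_Icc] at hx
    have h1 := rate_div_rate_lt_totalShare_sq θ hJ hx.1 hx.2.le hb h
    have hB := totalShare_pos θ J x
    rw [div_lt_iff₀ (totalProfitRate_pos θ hJ x)] at h1
    rw [(hasDerivAt_completedRevenue θ x).deriv, sub_pos, div_lt_iff₀ (by positivity)]
    linarith
  · left
    refine strictAntiOn_of_deriv_neg (convex_Icc a s) hcont.continuousOn (fun x hx => ?_)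
      (Set.left_mem_Icc.2 has.le) (Set.right_mem_Icc.2 has.le) has
    rw [interior_Icc] at hx
    have h1 : totalShare θ J x ^ 2 < totalShareRate θ J x / totalProfitRate θ J x := by
      by_contra! hx'
      exact h (rate_div_rate_lt_totalShare_sq θ hJ hx.2 hsb.le hb hx').le
    have hB := totalShare_pos θ J x
    rw [lt_div_iff₀ (totalProfitRate_pos θ hJ x)] at h1
    rw [(hasDerivAt_completedRevenue θ x).deriv, sub_neg, lt_div_iff₀ (by positivity)]
    linarith

theorem completedRevenue_eq_totalProfit {s : ℝ} (hs : totalShare θ J s = 1) :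
    completedRevenue θ J s = totalProfit θ J s := by
  simp [completedRevenue, hs]

theorem totalShare_insert {i : Fin n} (hi : i ∉ J) (s : ℝ) :
    totalShare θ (insert i J) s = totalShare θ J s + share (θ i + s) := by
  rw [totalShare, totalShare, Finset.sum_insert hi]
  ring

theorem totalProfit_insert {i : Fin n} (hi : i ∉ J) (s : ℝ) :
    totalProfit θ (insert i J) s = totalProfit θ J s + profit (θ i + s) := by
  rw [totalProfit, totalProfit, Finset.sum_insert hi]
  ring

theorem completedRevenue_eq_totalProfit_insert {i : Fin n} (hi : i ∉ J) {s : ℝ}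
    (hs : totalShare θ (insert i J) s = 1) :
    completedRevenue θ J s = totalProfit θ (insert i J) s := by
  rw [totalShare_insert θ hi] at hs
  rw [totalProfit_insert θ hi, completedRevenue, eq_sub_of_add_eq hs, one_div_one_sub_share]
  ring

/-! ### A dominant seller earns more alone. -/

/-- `r` is the dominant seller's profit, `w` its monopoly profit, `Q` the outside share and `Y` the
share of the other sellers. With `u = Y / (1 - Y)`, assuming `w ≤ r + u` leads to `r ≤ r * (exp u *
(1 - u))`, contradicting `exp u * (1 - u) < 1`. -/
theorem add_div_one_sub_lt {r w Q Y : ℝ} (hr : 1 ≤ r) (hQ : 0 < Q)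
    (hY : Y = 1 - Q - r / (1 + r)) (hY0 : 0 < Y)
    (h : r / (1 + r) * Real.exp r = w * Real.exp w * Q) : r + Y / (1 - Y) < w := by
  have hr0 : 0 < r := by linarith
  have hQr : Q * (1 + r) = 1 - Y * (1 + r) := by
    rw [hY]; field_simp; ring
  have hYr : Y * (1 + r) < 1 := by nlinarith
  have hY2 : Y < 1 / 2 := by nlinarith
  obtain ⟨u, hu⟩ : ∃ u, u = Y / (1 - Y) := ⟨_, rfl⟩
  have hu_eq : u * (1 - Y) = Y := by rw [hu]; exact div_mul_cancel₀ _ (by linarith)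
  have hu0 : 0 < u := by rw [hu]; exact div_pos hY0 (by linarith)
  have hexp : Real.exp u * (1 - u) < 1 := by
    have h1 := Real.add_one_lt_exp (x := -u) (by linarith)
    have h2 : Real.exp u * Real.exp (-u) = 1 := by rw [← Real.exp_add]; simp
    have h3 := mul_lt_mul_of_pos_left h1 (Real.exp_pos u)
    linarith
  rw [← hu]
  by_contra! hwr
  have h1 : w * Real.exp w ≤ (r + u) * Real.exp (r + u) :=
    mul_le_mul hwr (Real.exp_le_exp.2 hwr) (Real.exp_pos _).le (by linarith)
  have h2 : r / (1 + r) ≤ Q * ((r + u) * Real.exp u) := by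
    have h3 := mul_le_mul_of_nonneg_right h1 hQ.le
    rw [← h, Real.exp_add] at h3
    refine le_of_mul_le_mul_right ?_ (Real.exp_pos r)
    linarith
  have h3 : r ≤ (1 - Y * (1 + r)) * ((r + u) * Real.exp u) := by
    rw [div_le_iff₀ (by linarith)] at h2
    rw [← hQr]
    linarith
  -- Both factors are compared using `r ≥ 1`.
  have h4 : (1 - Y * (1 + r)) * (r + u) ≤ (1 - 2 * Y) * (r * (1 + u)) :=
    mul_le_mul (by nlinarith) (by nlinarith) (by linarith) (by linarith)
  have h5 : (1 - 2 * Y) * (1 + u) = 1 - u := by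
    linear_combination 2 * hu_eq
  have h6 := mul_le_mul_of_nonneg_right h4 (Real.exp_pos u).le
  have h7 : (1 - 2 * Y) * (r * (1 + u)) * Real.exp u = r * (Real.exp u * (1 - u)) := by
    rw [← h5]; ring
  have h8 := mul_lt_mul_of_pos_left hexp hr0
  linarith

/-- Merging sellers raises profit: `q / (1 - q) ≤ q / (1 - Y)` whenever `q ≤ Y`. The leftover share
`1 - B` counts as one more seller. -/
theorem totalProfit_add_le {B Y s : ℝ} (hY1 : Y < 1) (hB : 0 < B) (hB1 : B ≤ 1)
    (hY : ∑ i ∈ J, share (θ i + s) + (1 - B) ≤ Y) :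
    totalProfit θ J s + (1 / B - 1) ≤ Y / (1 - Y) := by
  have h0 : ∀ i ∈ J, 0 ≤ share (θ i + s) := fun i _ => (share_pos _).le
  have h00 := Finset.sum_nonneg h0
  have h1 : totalProfit θ J s ≤ ∑ i ∈ J, share (θ i + s) / (1 - Y) := by
    refine Finset.sum_le_sum fun i hi => ?_
    have h2 := Finset.single_le_sum h0 hi
    rw [← share_mul_one_add_profit, ← one_div_one_sub_share, mul_one_div]
    exact div_le_div_of_nonneg_left (share_pos _).le (by linarith) (by linarith)
  have h2 : 1 / B - 1 ≤ (1 - B) / (1 - Y) := by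
    have : 1 / B - 1 = (1 - B) / B := by
      field_simp
    rw [this]
    exact div_le_div_of_nonneg_left (by linarith) (by linarith) (by linarith)
  rw [← Finset.sum_div] at h1
  calc totalProfit θ J s + (1 / B - 1)
      ≤ (∑ i ∈ J, share (θ i + s) + (1 - B)) / (1 - Y) := by
        rw [add_div]
        exact add_le_add h1 h2
    _ ≤ Y / (1 - Y) := div_le_div_of_nonneg_right hY (by linarith)

/-- Alone in the market, a product earns more than any market of at least two sellers in which it
has demand at least one half. -/
theorem completedRevenue_lt_of_one_le_profit {j : Fin n} (hj : j ∈ J) {s s' : ℝ}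
    (hs : totalShare θ J s ≤ 1) (hlt : Real.exp s + share (θ j + s) < 1)
    (hr : 1 ≤ profit (θ j + s)) (hs' : totalShare θ {j} s' = 1) :
    completedRevenue θ J s < totalProfit θ {j} s' := by
  have hB := totalShare_pos θ J s
  have hV : completedRevenue θ J s = profit (θ j + s) +
      (totalProfit θ (J.erase j) s + (1 / totalShare θ J s - 1)) := by
    rw [completedRevenue, totalProfit, totalProfit, ← Finset.add_sum_erase _ _ hj]
    ring
  have hsum : totalShare θ J s = Real.exp s + share (θ j + s) +
      ∑ i ∈ J.erase j, share (θ i + s) := by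
    rw [totalShare, ← Finset.add_sum_erase _ _ hj]
    ring
  have hw_eq : totalProfit θ {j} s' = profit (θ j + s') := by simp [totalProfit]
  have hrest : totalProfit θ (J.erase j) s + (1 / totalShare θ J s - 1) ≤
      (1 - Real.exp s - share (θ j + s)) / (1 - (1 - Real.exp s - share (θ j + s))) :=
    totalProfit_add_le θ (by linarith [Real.exp_pos s, share_pos (θ j + s)]) hB hs
      (by rw [hsum]; linarith)
  -- In the monopoly the outside share is `1 / (1 + w)`, which cancels against the share `w / (1 +
  -- w)`.
  have hw : profit (θ j + s') * Real.exp (profit (θ j + s')) = Real.exp (θ j - 1) := by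
    have h1 := share_mul_exp_profit (θ j) s'
    have h2 := one_sub_share (θ j + s')
    rw [totalShare, Finset.sum_singleton] at hs'
    have hw0 := profit_pos (θ j + s')
    rw [eq_sub_of_add_eq hs', h2, share] at h1
    field_simp at h1
    exact h1
  have h := add_div_one_sub_lt (w := profit (θ j + s')) hr (Real.exp_pos s) rfl
    (show 0 < 1 - Real.exp s - share (θ j + s) by linarith)
    (by rw [hw]; exact share_mul_exp_profit (θ j) s)
  rw [hV, hw_eq]
  exact (add_le_add_right hrest _).trans_lt h

end

/-! ### Structure of optimal sets. -/

noncomputable section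

variable {n : ℕ} {θ : Fin n → ℝ} {S : Finset (Fin n)}

theorem IsRevenueOptimal.profit_lt_one (hS : IsRevenueOptimal θ S) (hcard : 2 ≤ S.card) {s : ℝ}
    (hs : totalShare θ S s = 1) {i : Fin n} (hi : i ∈ S) : profit (θ i + s) < 1 := by
  by_contra! hle
  obtain ⟨s', hs'⟩ := exists_totalShare_eq_one θ {i}
  have hne : (S.erase i).Nonempty := by
    rw [← Finset.card_pos, Finset.card_erase_of_mem hi]
    omega
  have hpos : 0 < ∑ j ∈ S.erase i, share (θ j + s) := Finset.sum_pos (fun _ _ => share_pos _) hne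
  have hlt : Real.exp s + share (θ i + s) < 1 := by
    rw [totalShare, ← Finset.add_sum_erase _ _ hi] at hs
    linarith
  have h1 := completedRevenue_lt_of_one_le_profit θ hi hs.le hlt hle hs'
  rw [completedRevenue_eq_totalProfit θ hs] at h1
  exact absurd (hS.totalProfit_le hs (Finset.singleton_nonempty i) hs') h1.not_ge

theorem share_lt_half {t : ℝ} (h : profit t < 1) : share t < 1 / 2 := by
  have := profit_pos t
  rw [share, div_lt_iff₀ (by linarith)]
  linarith

/-- The points `a < s < b` are the equilibria of `J` completed by `j`, by `i`, and by nobody: a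
stronger last seller leaves a smaller outside share. -/
theorem IsRevenueOptimal.quality_le (hS : IsRevenueOptimal θ S) (hcard : 2 ≤ S.card)
    {i j : Fin n} (hi : i ∈ S) (hj : j ∉ S) : θ j ≤ θ i := by
  by_contra! hij
  obtain ⟨J, hiJ, rfl⟩ : ∃ J, i ∉ J ∧ insert i J = S :=
    ⟨S.erase i, Finset.notMem_erase i S, Finset.insert_erase hi⟩
  have hjJ : j ∉ J := fun h => hj (Finset.mem_insert_of_mem h)
  have hJ : J.Nonempty := by
    rw [← Finset.card_pos]
    rw [Finset.card_insert_of_notMem hiJ] at hcard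
    omega
  obtain ⟨s, hs⟩ := exists_totalShare_eq_one θ (insert i J)
  obtain ⟨a, ha⟩ := exists_totalShare_eq_one θ (insert j J)
  obtain ⟨b, hb⟩ := exists_totalShare_eq_one θ J
  have has : a < s := by
    rw [← (strictMono_totalShare θ (insert j J)).lt_iff_lt, ha, ← hs, totalShare_insert θ hiJ,
      totalShare_insert θ hjJ]
    have := strictMono_share (show θ i + s < θ j + s by linarith)
    linarith
  have hsb : s < b := by
    rw [← (strictMono_totalShare θ J).lt_iff_lt, hb, ← hs, totalShare_insert θ hiJ]
    linarith [share_pos (θ i + s)]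
  have hVs := completedRevenue_eq_totalProfit_insert θ hiJ hs
  have hVa : completedRevenue θ J a ≤ completedRevenue θ J s := by
    rw [hVs, completedRevenue_eq_totalProfit_insert θ hjJ ha]
    exact hS.totalProfit_le hs (Finset.insert_nonempty _ _) ha
  obtain ⟨m, hmJ, hm⟩ := Finset.exists_max_image J θ hJ
  -- `2 - log 2` is the argument at which `profit` equals one, so `c` is where the best product of
  -- `J` reaches profit one.
  have hprofit : profit (θ m + (2 - Real.log 2 - θ m)) = 1 :=
    profit_eq_of_log one_pos (by rw [Real.log_one]; norm_num; ring)
  set c := 2 - Real.log 2 - θ m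
  have hsc : s < c := by
    have h := hS.profit_lt_one hcard hs (Finset.mem_insert_of_mem hmJ)
    rw [← hprofit, strictMono_profit.lt_iff_lt] at h
    linarith
  have hc : ∀ k ∈ J, ∀ t ≤ c, profit (θ k + t) ≤ 1 := fun k hk t ht => by
    rw [← hprofit]
    exact strictMono_profit.monotone (by linarith [hm k hk])
  rcases le_or_gt b c with hbc | hcb
  · have h := completedRevenue_lt_max θ hJ has hsb fun k hk => hc k hk b hbc
    have hVb : completedRevenue θ J b ≤ completedRevenue θ J s := by
      rw [hVs, completedRevenue_eq_totalProfit θ hb]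
      exact hS.totalProfit_le hs hJ hb
    exact absurd (max_le hVa hVb) h.not_ge
  -- The interval is cut at `c`; the value there need not come from a set of available products, but
  -- the monopoly of `m` beats it.
  · have h := completedRevenue_lt_max θ hJ has hsc fun k hk => hc k hk c le_rfl
    obtain ⟨s', hs'⟩ := exists_totalShare_eq_one θ {m}
    have hBc : totalShare θ J c < 1 := by
      rw [← hb]
      exact strictMono_totalShare θ J hcb
    have hlt : Real.exp c + share (θ m + c) < 1 := by
      refine lt_of_le_of_lt ?_ hBc
      rw [totalShare]
      gcongr
      exact Finset.single_le_sum (f := fun k => share (θ k + c)) (fun _ _ => (share_pos _).le) hmJ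
    have h1 := completedRevenue_lt_of_one_le_profit θ hmJ hBc.le hlt hprofit.ge hs'
    have h2 := hS.totalProfit_le hs (Finset.singleton_nonempty m) hs'
    have hVc : completedRevenue θ J c ≤ completedRevenue θ J s := by
      rw [hVs]
      exact (h1.trans_le h2).le
    exact absurd (max_le hVa hVc) h.not_ge

theorem card_topProducts {k : ℕ} (hk : k ≤ n) : (topProducts n k).card = k := by
  rw [topProducts, Fin.card_filter_val_lt]
  omega

/-- A set containing the best products and the set of the first ones carry the same qualities. -/
theorem sum_topProducts_eq (hθ : Antitone θ) (hS : ∀ i ∈ S, ∀ j ∉ S, θ j ≤ θ i) (φ : ℝ → ℝ) :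
    ∑ i ∈ topProducts n S.card, φ (θ i) = ∑ i ∈ S, φ (θ i) := by
  set T := topProducts n S.card with hT
  have hcard : T.card = S.card :=
    card_topProducts (by simpa using Finset.card_le_univ S)
  -- Indices outside `T` follow those in `T`, so sortedness gives one inequality and `hS` the other.
  have heq : ∀ a ∈ S \ T, ∀ b ∈ T \ S, θ a = θ b := by
    intro a ha b hb
    rw [Finset.mem_sdiff] at ha hb
    refine le_antisymm (hθ ?_) (hS a ha.1 b hb.2)
    have h1 := ha.2
    have h2 := hb.1
    simp only [hT, topProducts, Finset.mem_filter, Finset.mem_univ, true_and] at h1 h2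
    rw [Fin.le_def]
    omega
  have hsd : (T \ S).card = (S \ T).card := by
    have h1 := Finset.card_sdiff_add_card_inter T S
    have h2 := Finset.card_sdiff_add_card_inter S T
    rw [Finset.inter_comm] at h2
    omega
  have hsum : ∑ i ∈ T \ S, φ (θ i) = ∑ i ∈ S \ T, φ (θ i) := by
    rcases (T \ S).eq_empty_or_nonempty with h0 | ⟨b, hb⟩
    · have h0' : S \ T = ∅ := by
        rw [← Finset.card_eq_zero, ← hsd, h0, Finset.card_empty]
      rw [h0, h0']
    · obtain ⟨a, ha⟩ : (S \ T).Nonempty := by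
        rw [← Finset.card_pos, ← hsd]
        exact Finset.card_pos.2 ⟨b, hb⟩
      rw [Finset.sum_eq_card_nsmul fun i hi => congrArg φ (heq a ha i hi).symm,
        Finset.sum_eq_card_nsmul fun i hi =>
          congrArg φ ((heq i hi b hb).trans (heq a ha b hb).symm), hsd]
  rw [← Finset.sum_inter_add_sum_sdiff T S, ← Finset.sum_inter_add_sum_sdiff S T, hsum,
    Finset.inter_comm]

theorem IsRevenueOptimal.topProducts (hθ : Antitone θ) (hS : IsRevenueOptimal θ S)
    (htop : ∀ i ∈ S, ∀ j ∉ S, θ j ≤ θ i) :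
    IsRevenueOptimal θ (topProducts n S.card) := by
  have hshare : totalShare θ (MNLBertrand.topProducts n S.card) = totalShare θ S :=
    funext fun s => congrArg _ (sum_topProducts_eq hθ htop fun x => share (x + s))
  have hprofit : totalProfit θ (MNLBertrand.topProducts n S.card) = totalProfit θ S :=
    funext fun s => sum_topProducts_eq hθ htop fun x => profit (x + s)
  obtain ⟨hne, R, hR, hmax⟩ := hS
  refine ⟨?_, R, ?_, hmax⟩
  · rw [← Finset.card_pos, card_topProducts (by simpa using Finset.card_le_univ S)]
    exact hne.card_pos
  · rw [isEquilibriumRevenue_iff, hshare, hprofit]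
    exact isEquilibriumRevenue_iff.1 hR

/-! ### The Lambert function. -/

theorem exists_isLambertW {x : ℝ} (hx : 0 < x) : ∃ w, 0 < w ∧ IsLambertW x w := by
  have hcont : Continuous fun w : ℝ => w * Real.exp w := by fun_prop
  obtain ⟨w, hw⟩ : x ∈ Set.range fun w : ℝ => w * Real.exp w :=
    mem_range_of_exists_le_of_exists_ge hcont ⟨0, by simpa using hx.le⟩
      ⟨x, le_mul_of_one_le_right hx.le (Real.one_le_exp hx.le)⟩
  have hpos : ∀ v : ℝ, v * Real.exp v = x → 0 < v := fun v hv =>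
    pos_of_mul_pos_left (hv ▸ hx) (Real.exp_pos v).le
  have hmono : ∀ u v : ℝ, 0 < u → u < v → u * Real.exp u < v * Real.exp v := fun u v hu huv =>
    mul_lt_mul huv (Real.exp_le_exp.2 huv.le) (Real.exp_pos _) (hu.trans huv).le
  refine ⟨w, hpos w hw, hw, fun v hv => ?_⟩
  rcases lt_trichotomy v w with h | h | h
  · have h1 := hmono v w (hpos v hv) h
    exact absurd (hv.trans hw.symm) h1.ne
  · exact h
  · have h1 := hmono w v (hpos w hw) h
    exact absurd (hw.trans hv.symm) h1.ne

/-- With `x = w * exp w` the claim reduces to `(2 - w) * exp w ≤ exp 1`, the tangent bound for `exp`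
at `0` taken at `1 - w`. -/
theorem IsLambertW.two_mul_div_le {x w : ℝ} (hx : 0 < x) (hw0 : 0 < w) (hw : IsLambertW x w) :
    2 * x / (Real.exp 1 + x) ≤ w := by
  have he := Real.exp_pos 1
  rw [div_le_iff₀ (by linarith), ← hw.1]
  have h1 := Real.add_one_le_exp (1 - w)
  have h2 : Real.exp (1 - w) * Real.exp w = Real.exp 1 := by
    rw [← Real.exp_add]; ring_nf
  have h3 := mul_le_mul_of_nonneg_right h1 (Real.exp_pos w).le
  rw [h2] at h3
  nlinarith [mul_le_mul_of_nonneg_left h3 hw0.le]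

end

end MNLBertrand

theorem mainTheorem11 (n : ℕ) (θ : Fin n → ℝ) (hθ_nonneg : ∀ i, 0 ≤ θ i) (hθ_sorted : Antitone θ)
    (S : Finset (Fin n)) (hS_card : 3 ≤ S.card) (hS : MNLBertrand.IsRevenueOptimal θ S) :
    MNLBertrand.IsRevenueOptimal θ (MNLBertrand.topProducts n S.card) ∧
      (∀ i ∈ S, ∀ j ∉ S, θ j ≤ θ i) ∧
      (∀ p : Fin n → ℝ, MNLBertrand.IsNashEquilibrium θ S p →
        ∀ i ∈ S, MNLBertrand.demand θ S p i < 1 / 2) ∧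
      (∀ x : ℝ, Real.exp (-1) ≤ x →
        ∃ w : ℝ, MNLBertrand.IsLambertW x w ∧ 2 * x / (Real.exp 1 + x) ≤ w) := by
  have hcard : 2 ≤ S.card := by omega
  have htop : ∀ i ∈ S, ∀ j ∉ S, θ j ≤ θ i := fun i hi j hj => hS.quality_le hcard hi hj
  refine ⟨hS.topProducts hθ_sorted htop, htop, fun p hp i hi => ?_, fun x hx => ?_⟩
  · obtain ⟨s, hs, -, hd⟩ := hp.exists_totalShare
    rw [hd i hi]
    exact MNLBertrand.share_lt_half (hS.profit_lt_one hcard hs hi)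
  · have hx0 : 0 < x := (Real.exp_pos _).trans_le hx
    obtain ⟨w, hw0, hw⟩ := MNLBertrand.exists_isLambertW hx0
    exact ⟨w, hw, hw.two_mul_div_le hx0 hw0⟩
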